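/- Let $k$ be a field of characteristic different from $2$ and $3$, let $d\in\{2,3\}$, and let $V_d=k^d$ with standard basis $e_1,\dots,e_d$. A $d\times d(2d-1)$ matrix $A$ over $k$ has its columns $c_{i,j}\in V_d$ labelled by the pairs $1\le i<j\le 2d$ (in dictionary order), with entry $a_{i,j}^l$ in column $(i,j)$ and row $l$; its associated simple tensor is $\otimes_{1\le i<j\le 2d}\,c_{i,j}\in V_d^{\otimes d(2d-1)}$, and for a linear map $D$ on this space we write $D(A)$ for its value at that tensor. Let $S_a=\{2a-1,2a\}$ for $1\le a\le d$. For $1\le i<j\le 2d$ let $ind(i,j)=a$ with $i\in S_a$ if $i+j$ is even, and $ind(i,j)=b$ with $j\in S_b$ if $i+j$ is odd. Let $E_d=\otimes_{1\le i<j\le 2d}\,e_{ind(i,j)}$. The $S^2$-diagonal of $A$ consists of the entries of $A$ in the positions where the matrix form of $E_d$ is nonzero, and $prod(diag^{S^2}(A))=\prod_{1\le i<j\le 2d}a_{i,j}^{ind(i,j)}$. The matrix $A$ is called $S^2$-Upper Triangular if $c_{i,j}\in\mathrm{span}(e_1,\dots,e_{ind(i,j)})$ for all $i<j$. A $\det^{S^2}$-map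 is a nonzero linear map $D:V_d^{\otimes d(2d-1)}\to k$ such that $D(\otimes_{i<j}v_{i,j})=0$ whenever $v_{x,y}=v_{x,z}=v_{y,z}$ for some $1\le x<y<z\le 2d$. Let $\mathcal P^{h,cf}_d(K_{2d})$ be the set of $d$-tuples $(\Gamma_1,\dots,\Gamma_d)$ of acyclic graphs on the vertex set $\{1,\dots,2d\}$, all with the same number of edges, whose edge sets partition the edge set of the complete graph $K_{2d}$. Let $\Gamma^{E_d}$ be the element whose $c$-th graph has the edges $(i,j)$, $i<j$, with $ind(i,j)=c$. A sign map is a map $\varepsilon:\mathcal P^{h,cf}_d(K_{2d})\to\{\pm1\}$ with $\varepsilon(\Gamma^{E_d})=(-1)^{d+1}$ and with $\varepsilon(\Lambda)=-\varepsilon(\Gamma)$ whenever $\Lambda\neq\Gamma$ agree on all edges outside some triangle $(x,y,z)$, $x<y<z$. Then: (1) A sign map $\varepsilon$ exists, and for every sign map $\varepsilon$ there is a $\det^{S^2}$-map $D$ with $$D(\otimes_{i<j}v_{i,j})=\sum_{\Gamma\in\mathcal P^{h,cf}_d(K_{2d})}\varepsilon(\Gamma)\prod_{c=1}^d\ \prod_{(i,j)\in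 E(\Gamma_c)}v_{i,j}^c$$ for all $v_{i,j}=(v_{i,j}^1,\dots,v_{i,j}^d)\in V_d$. (2) For every $\det^{S^2}$-map, denoted $\det^{S^2}$ (in particular for the one in (1)), and every $S^2$-Upper Triangular $d\times d(2d-1)$ matrix $A$, $$\det^{S^2}(A)=\det^{S^2}(E_d)\cdot prod(diag^{S^2}(A)).$$ -/

import Mathlib

open scoped TensorProduct

/-- The pairs `(i, j)` with `i < j` of vertices of the complete graph on `2 * d` vertices. The vertex
`i` of `{1, …, 2d}` is represented by `i - 1 : Fin (2 * d)`. There are `d * (2 * d - 1)` such pairs;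
they label the columns of a `d × d(2d-1)` matrix. -/
abbrev S2Pair (d : ℕ) : Type := {p : Fin (2 * d) × Fin (2 * d) // p.1 < p.2}

/-- A `d × d(2d-1)` matrix, with columns labelled by the pairs `(i, j)`, `i < j`. -/
abbrev S2Matrix (d : ℕ) (k : Type*) : Type _ := Matrix (Fin d) (S2Pair d) k

/-- The tensor space `V_d^{⊗ d(2d-1)}`, `V_d = k^d`, with factors labelled by the pairs. -/
abbrev S2Tensor (d : ℕ) (k : Type*) [Field k] : Type _ := ⨂[k] _ : S2Pair d, (Fin d → k)

/-- The block containing a vertex: `S_a = {2a-1, 2a}` in `1`-based numbering, that is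
`{2a, 2a+1}` in `0`-based numbering. -/
def s2Block {d : ℕ} (i : Fin (2 * d)) : Fin d := ⟨i.val / 2, by have := i.isLt; omega⟩

/-- The index `a` with `e_{i,j} = e_a` in the distinguished tensor `E_d`: the block of `i` if `i + j`
is even, the block of `j` if `i + j` is odd. (The parity of `i + j` does not depend on whether one
counts from `0` or from `1`.) -/
def s2Index {d : ℕ} (p : S2Pair d) : Fin d :=
  if Even (p.1.1.val + p.1.2.val) then s2Block p.1.1 else s2Block p.1.2

/-- The matrix form of `E_d`: the column `(i, j)` is the basis vector `e_{i,j}`. -/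
def s2Identity (d : ℕ) (k : Type*) [Field k] : S2Matrix d k :=
  Matrix.of fun a p => (Pi.single (s2Index p) 1 : Fin d → k) a

/-- The simple tensor `⊗_{i<j} c_{i,j}` associated with a matrix with columns `c_{i,j}`. -/
noncomputable def s2SimpleTensor {d : ℕ} {k : Type*} [Field k] (A : S2Matrix d k) : S2Tensor d k :=
  PiTensorProduct.tprod k fun p => A.col p

open Classical in
/-- The `S²`-diagonal indicator set: positions of the nonzero entries of the matrix form of `E_d`. -/
noncomputable def s2DiagIndicator (d : ℕ) (k : Type*) [Field k] : Finset (S2Pair d × Fin d) :=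
  Finset.univ.filter fun q => s2Identity d k q.2 q.1 ≠ 0

/-- The product of the `S²`-diagonal of `A` (one factor for each position of the diagonal). -/
noncomputable def s2DiagProd {d : ℕ} {k : Type*} [Field k] (A : S2Matrix d k) : k :=
  ∏ q ∈ s2DiagIndicator d k, A q.2 q.1

/-- `A` is `S²`-upper triangular: each column `c_{i,j}` is a combination of `e_1, …, e_l`, where
`l = ind(i, j)` is the row in which the column `(i, j)` meets the `S²`-diagonal. -/
def IsS2UpperTriangular {d : ℕ} {k : Type*} [Field k] (A : S2Matrix d k) : Prop :=
  ∀ (p : S2Pair d) (l : Fin d), (p, l) ∈ s2DiagIndicator d k →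
    ∃ α : Fin d → k, A.col p = ∑ m ∈ Finset.Iic l, α m • (Pi.single m 1 : Fin d → k)

/-- The defining property of the map `det^{S²}`: a nontrivial linear form on `V_d^{⊗ d(2d-1)}` that
vanishes on `⊗ v_{i,j}` as soon as `v_{x,y} = v_{x,z} = v_{y,z}` for some `x < y < z`. -/
structure IsDetS2 {d : ℕ} {k : Type*} [Field k] (D : S2Tensor d k →ₗ[k] k) : Prop where
  nontrivial : D ≠ 0
  vanish : ∀ (v : S2Pair d → Fin d → k) (x y z : Fin (2 * d)) (hxy : x < y) (hyz : y < z),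
    v ⟨(x, y), hxy⟩ = v ⟨(x, z), hxy.trans hyz⟩ →
    v ⟨(x, z), hxy.trans hyz⟩ = v ⟨(y, z), hyz⟩ →
    D (PiTensorProduct.tprod k v) = 0

/-- The homogeneous cycle-free edge `d`-partitions of the complete graph on `2 * d` vertices. -/
structure IsHCFPartition {d : ℕ} (Γ : Fin d → SimpleGraph (Fin (2 * d))) : Prop where
  disjoint : ∀ i j, i < j → (Γ i).edgeSet ∩ (Γ j).edgeSet = ∅
  union : ⋃ i, (Γ i).edgeSet = (⊤ : SimpleGraph (Fin (2 * d))).edgeSet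
  cycleFree : ∀ i, (Γ i).IsAcyclic
  homogeneous : ∀ i j, i < j → (Γ i).edgeSet.ncard = (Γ j).edgeSet.ncard

/-- The set of homogeneous cycle-free edge `d`-partitions of the complete graph `K_{2d}`. -/
abbrev HCFPartition (d : ℕ) : Type :=
  {Γ : Fin d → SimpleGraph (Fin (2 * d)) // IsHCFPartition Γ}

/-- The edge `d`-partition associated with `E_d`: the pair `(x, y)` is an edge of the `c`-th graph
exactly if `e_{x,y} = e_c`. -/
def s2EPartition (d : ℕ) : Fin d → SimpleGraph (Fin (2 * d)) := fun c =>
  SimpleGraph.fromEdgeSet {s | ∃ p : S2Pair d, s = s(p.1.1, p.1.2) ∧ s2Index p = c}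

/-- `Λ` is the involution `Γ^{(x,y,z)}` of `Γ`: the two (homogeneous, cycle-free) partitions are
different, and they agree on all edges outside the triangle `(x, y, z)`. -/
def IsInvolutionOf {d : ℕ} (Γ Λ : HCFPartition d) (x y z : Fin (2 * d)) : Prop :=
  Λ ≠ Γ ∧ ∀ (c : Fin d) (s : Sym2 (Fin (2 * d))), s ≠ s(x, y) → s ≠ s(x, z) → s ≠ s(y, z) →
    (s ∈ (Λ.1 c).edgeSet ↔ s ∈ (Γ.1 c).edgeSet)

/-- The defining property of the sign map `ε_d` on homogeneous cycle-free edge `d`-partitions: it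
changes sign under every involution, and it is `(-1)^{d+1}` at the partition associated with `E_d`. -/
structure IsS2Sign {d : ℕ} (ε : HCFPartition d → ℤˣ) : Prop where
  involution : ∀ (Γ Λ : HCFPartition d) (x y z : Fin (2 * d)), x < y → y < z →
    IsInvolutionOf Γ Λ x y z → ε Λ = -ε Γ
  normalized : ∃ h : IsHCFPartition (s2EPartition d), ε ⟨s2EPartition d, h⟩ = (-1) ^ (d + 1)

open Classical in
/-- The monomial `M_Γ(⊗ v_{i,j}) = ∏_c ∏_{(i,j) ∈ E(Γ_c)} v_{i,j}^c`. -/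
noncomputable def s2Monomial {d : ℕ} {k : Type*} [Field k]
    (Γ : Fin d → SimpleGraph (Fin (2 * d))) (v : S2Pair d → Fin d → k) : k :=
  ∏ c : Fin d, ∏ p : S2Pair d with (Γ c).Adj p.1.1 p.1.2, v p c

open Classical in
/-- The sum `∑_Γ ε(Γ) M_Γ(⊗ v_{i,j})` over the homogeneous cycle-free edge `d`-partitions. -/
noncomputable def s2SignedSum {d : ℕ} {k : Type*} [Field k]
    (ε : HCFPartition d → ℤˣ) (v : S2Pair d → Fin d → k) : k :=
  ∑ Γ : HCFPartition d, ((ε Γ : ℤ) : k) * s2Monomial Γ.1 v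

/-! A tensor product of basis vectors is a colouring of the edges of `K_{2d}` by `d` colours.
Polarizing the vanishing on triangles with equal columns gives a six-term relation: the values at
all rearrangements of the three colours of a triangle sum to zero. If `2` is not a zero divisor,
this relation shortens monochromatic cycles down to a monochromatic triangle, so the value vanishes
unless every colour class is a forest (`VanishesOnTriangles.colouringValue_eq_zero_of_isCycle`). A
forest has at most `2d - 1` edges and there are `d(2d - 1)` edges in all, so each class is then a
spanning tree.

The product formula follows. Expanding at an upper triangular matrix, only colourings pointwise at
most `s2Index` contribute, while all forest colourings have the same sum of colours. Hence only
`s2Index` survives.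

Sign maps come from an integral form, `incidenceDet`, whose matrix rows are columns tensored with
reduced incidence rows. It vanishes on triangles because incidence rows around a triangle are
dependent; it is `±1` at spanning tree colourings and `0` at all others. The six-term relation then
shows that every partition can be changed inside any given triangle, and a connectivity argument
shows that such a change reverses the sign. Conversely, any sign map forces the changed partition to
be unique, so its signed sum cancels in pairs on triangles with equal columns. -/

/-! ### Multilinear maps vanishing on monochromatic triangles -/

/-- Polarization: a multilinear map that vanishes when three given arguments coincide has vanishing
symmetrization in these arguments. -/
theorem MultilinearMap.sum_perm_three_eq_zero {R ι M : Type*} [CommRing R] [DecidableEq ι]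
    [AddCommGroup M] [Module R M]
    (φ : MultilinearMap R (fun _ : ι => M) R) {p q r : ι} (hpq : p ≠ q) (hpr : p ≠ r) (hqr : q ≠ r)
    (h : ∀ v : ι → M, v p = v q → v q = v r → φ v = 0) (v : ι → M) {T : M → M → M → R}
    (hT : ∀ a b c, T a b c =
      φ (Function.update (Function.update (Function.update v p a) q b) r c)) (a b c : M) :
    T a b c + T a c b + T b a c + T b c a + T c a b + T c b a = 0 := by
  have h3 : ∀ a b c c', T a b (c + c') = T a b c + T a b c' := fun a b c c' => by
    simp only [hT, φ.map_update_add]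
  have h2 : ∀ a b b' c, T a (b + b') c = T a b c + T a b' c := fun a b b' c => by
    simp only [hT, Function.update_comm hqr, φ.map_update_add]
  have h1 : ∀ a a' b c, T (a + a') b c = T a b c + T a' b c := fun a a' b c => by
    simp only [hT, Function.update_comm hpq, Function.update_comm hpr, φ.map_update_add]
  have h0 : ∀ a, T a a a = 0 := fun a => by
    rw [hT]
    apply h
    · simp [hpq, hpr, hqr]
    · simp [hqr]
  -- Inclusion-exclusion over the subsets of `{a, b, c}` isolates the terms using each argument
  -- once.
  have habc := h0 (a + b + c)
  have hab := h0 (a + b)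
  have hac := h0 (a + c)
  have hbc := h0 (b + c)
  have ha := h0 a
  have hb := h0 b
  have hc := h0 c
  simp only [h1, h2, h3] at habc hab hac hbc
  linear_combination habc - hab - hac - hbc + ha + hb + hc

/-- The pair formed by two different vertices, in either order. -/
def s2PairOf {d : ℕ} (u v : Fin (2 * d)) (h : u ≠ v) : S2Pair d :=
  if huv : u < v then ⟨(u, v), huv⟩ else ⟨(v, u), lt_of_le_of_ne (not_lt.1 huv) h.symm⟩

theorem s2PairOf_comm {d : ℕ} (u v : Fin (2 * d)) (h : u ≠ v) :
    s2PairOf u v h = s2PairOf v u h.symm := by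
  unfold s2PairOf
  split_ifs <;> first | rfl | (exfalso; order)

theorem s2PairOf_of_lt {d : ℕ} {u v : Fin (2 * d)} (h : u < v) :
    s2PairOf u v h.ne = ⟨(u, v), h⟩ := dif_pos h

theorem sym2_s2PairOf {d : ℕ} (u v : Fin (2 * d)) (h : u ≠ v) :
    s((s2PairOf u v h).1.1, (s2PairOf u v h).1.2) = s(u, v) := by
  unfold s2PairOf
  split_ifs
  · rfl
  · exact Sym2.eq_swap

theorem S2Pair.sym2_injective {d : ℕ} :
    Function.Injective fun p : S2Pair d => s(p.1.1, p.1.2) := by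
  rintro ⟨⟨a, b⟩, hab⟩ ⟨⟨a', b'⟩, hab'⟩ h
  simp only [Sym2.eq_iff] at h
  dsimp only at hab hab'
  rcases h with ⟨rfl, rfl⟩ | ⟨rfl, rfl⟩
  · rfl
  · exact absurd hab (not_lt.2 hab'.le)

theorem s2PairOf_eq_iff {d : ℕ} {u v u' v' : Fin (2 * d)} {h : u ≠ v} {h' : u' ≠ v'} :
    s2PairOf u v h = s2PairOf u' v' h' ↔ s(u, v) = s(u', v') := by
  rw [← S2Pair.sym2_injective.eq_iff]
  simp only [sym2_s2PairOf]

theorem s2PairOf_triangle_ne {d : ℕ} {x y z : Fin (2 * d)} (hxy : x ≠ y) (hxz : x ≠ z)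
    (hyz : y ≠ z) : s2PairOf x y hxy ≠ s2PairOf x z hxz ∧
      s2PairOf x y hxy ≠ s2PairOf y z hyz ∧ s2PairOf x z hxz ≠ s2PairOf y z hyz := by
  simp only [ne_eq, s2PairOf_eq_iff, Sym2.eq_iff]
  refine ⟨?_, ?_, ?_⟩ <;> grind

/-- A multilinear map in the columns that vanishes on monochromatic triangles. -/
def VanishesOnTriangles {d : ℕ} {R : Type*} [CommRing R]
    (φ : MultilinearMap R (fun _ : S2Pair d => Fin d → R) R) : Prop :=
  ∀ (v : S2Pair d → Fin d → R) (x y z : Fin (2 * d)) (hxy : x < y) (hyz : y < z),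
    v ⟨(x, y), hxy⟩ = v ⟨(x, z), hxy.trans hyz⟩ →
    v ⟨(x, z), hxy.trans hyz⟩ = v ⟨(y, z), hyz⟩ → φ v = 0

/-- The condition is symmetric in the three vertices. The unordered form is needed because
consecutive vertices of a cycle come in no particular order. -/
theorem VanishesOnTriangles.eq_zero {d : ℕ} {R : Type*} [CommRing R]
    {φ : MultilinearMap R (fun _ : S2Pair d => Fin d → R) R} (hφ : VanishesOnTriangles φ)
    (v : S2Pair d → Fin d → R) {x y z : Fin (2 * d)} (hxy : x ≠ y) (hxz : x ≠ z) (hyz : y ≠ z)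
    (h1 : v (s2PairOf x y hxy) = v (s2PairOf x z hxz))
    (h2 : v (s2PairOf x z hxz) = v (s2PairOf y z hyz)) : φ v = 0 := by
  rcases lt_or_gt_of_ne hxy with hx | hx <;> rcases lt_or_gt_of_ne hxz with hz | hz <;>
    rcases lt_or_gt_of_ne hyz with hy | hy <;> try (exfalso; order)
  · rw [s2PairOf_of_lt hx, s2PairOf_of_lt hz] at h1
    rw [s2PairOf_of_lt hz, s2PairOf_of_lt hy] at h2
    exact hφ v x y z hx hy h1 h2
  · rw [s2PairOf_of_lt hx, s2PairOf_of_lt hz] at h1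
    rw [s2PairOf_of_lt hz, s2PairOf_comm, s2PairOf_of_lt hy] at h2
    exact hφ v x z y hz hy h1.symm (h1.trans h2)
  · rw [s2PairOf_of_lt hx, s2PairOf_comm x z, s2PairOf_of_lt hz] at h1
    rw [s2PairOf_comm x z, s2PairOf_of_lt hz, s2PairOf_comm, s2PairOf_of_lt hy] at h2
    exact hφ v z x y hz hx h2 (h2.symm.trans h1.symm)
  · rw [s2PairOf_comm, s2PairOf_of_lt hx, s2PairOf_of_lt hz] at h1
    rw [s2PairOf_of_lt hz, s2PairOf_of_lt hy] at h2
    exact hφ v y x z hx hz (h1.trans h2) h2.symm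
  · rw [s2PairOf_comm, s2PairOf_of_lt hx, s2PairOf_comm x z, s2PairOf_of_lt hz] at h1
    rw [s2PairOf_comm x z, s2PairOf_of_lt hz, s2PairOf_of_lt hy] at h2
    exact hφ v y z x hy hz (h2.symm.trans h1.symm) h1
  · rw [s2PairOf_comm, s2PairOf_of_lt hx, s2PairOf_comm x z, s2PairOf_of_lt hz] at h1
    rw [s2PairOf_comm x z, s2PairOf_of_lt hz, s2PairOf_comm, s2PairOf_of_lt hy] at h2
    exact hφ v z y x hy hx h2.symm h1.symm

/-- The value at a tensor product of standard basis vectors, as a function of the edge colouring. -/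
def colouringValue {d : ℕ} {R : Type*} [CommRing R]
    (φ : MultilinearMap R (fun _ : S2Pair d => Fin d → R) R) (g : S2Pair d → Fin d) : R :=
  φ fun p => Pi.single (g p) 1

/-- Recolouring of three edges. -/
def recolour {d : ℕ} (g : S2Pair d → Fin d) (p q r : S2Pair d) (a b c : Fin d) : S2Pair d → Fin d :=
  Function.update (Function.update (Function.update g p a) q b) r c

/-- The six-term relation: polarization on the three edges of a triangle, evaluated at basis
vectors. -/
theorem VanishesOnTriangles.sum_recolour {d : ℕ} {R : Type*} [CommRing R]
    {φ : MultilinearMap R (fun _ : S2Pair d => Fin d → R) R} (hφ : VanishesOnTriangles φ)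
    (g : S2Pair d → Fin d) {x y z : Fin (2 * d)} (hxy : x ≠ y) (hxz : x ≠ z) (hyz : y ≠ z)
    {T : Fin d → Fin d → Fin d → R} (hT : ∀ a b c, T a b c = colouringValue φ
      (recolour g (s2PairOf x y hxy) (s2PairOf x z hxz) (s2PairOf y z hyz) a b c))
    (a b c : Fin d) : T a b c + T a c b + T b a c + T b c a + T c a b + T c b a = 0 := by
  obtain ⟨n1, n2, n3⟩ := s2PairOf_triangle_ne hxy hxz hyz
  have h := φ.sum_perm_three_eq_zero n1 n2 n3 (fun v h1 h2 => hφ.eq_zero v hxy hxz hyz h1 h2)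
    (fun p => Pi.single (g p) 1) (fun _ _ _ => rfl)
    (Pi.single a (1 : R)) (Pi.single b 1) (Pi.single c 1)
  have hT' : ∀ a b c, T a b c = φ (Function.update (Function.update (Function.update
      (fun p => Pi.single (g p) (1 : R)) (s2PairOf x y hxy) (Pi.single a 1))
      (s2PairOf x z hxz) (Pi.single b 1)) (s2PairOf y z hyz) (Pi.single c 1)) := by
    intro a b c
    rw [hT, colouringValue]
    congr 1
    funext p
    simp only [recolour, Function.update_apply]
    split_ifs <;> rfl
  simpa only [hT'] using h

/-! ### Edge colourings and their colour classes -/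

/-- The graph formed by the edges of colour `c`. -/
def colourGraph {d : ℕ} (g : S2Pair d → Fin d) (c : Fin d) : SimpleGraph (Fin (2 * d)) :=
  SimpleGraph.fromEdgeSet {s | ∃ p : S2Pair d, s = s(p.1.1, p.1.2) ∧ g p = c}

theorem colourGraph_adj {d : ℕ} {g : S2Pair d → Fin d} {c : Fin d} {u v : Fin (2 * d)} :
    (colourGraph g c).Adj u v ↔ ∃ h : u ≠ v, g (s2PairOf u v h) = c := by
  rw [colourGraph, SimpleGraph.fromEdgeSet_adj]
  constructor
  · rintro ⟨⟨p, hp, hg⟩, h⟩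
    refine ⟨h, ?_⟩
    rwa [show s2PairOf u v h = p from S2Pair.sym2_injective ((sym2_s2PairOf u v h).trans hp)]
  · rintro ⟨h, hg⟩
    exact ⟨⟨_, (sym2_s2PairOf u v h).symm, hg⟩, h⟩

theorem S2Pair.eq_s2PairOf {d : ℕ} (p : S2Pair d) : p = s2PairOf p.1.1 p.1.2 p.2.ne := by
  rw [s2PairOf_of_lt p.2]

theorem colourGraph_adj_pair {d : ℕ} {g : S2Pair d → Fin d} {c : Fin d} {p : S2Pair d} :
    (colourGraph g c).Adj p.1.1 p.1.2 ↔ g p = c := by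
  rw [colourGraph_adj]
  exact ⟨fun ⟨_, h⟩ => by rwa [S2Pair.eq_s2PairOf p], fun h => ⟨p.2.ne, by
    rwa [← S2Pair.eq_s2PairOf]⟩⟩

theorem recolour_self {d : ℕ} (g : S2Pair d → Fin d) (p q r : S2Pair d) :
    recolour g p q r (g p) (g q) (g r) = g := by
  simp [recolour]

/-- The value of a multilinear map vanishing on monochromatic triangles is zero at a colouring with
a monochromatic cycle. -/
theorem VanishesOnTriangles.colouringValue_eq_zero_of_isCycle {d : ℕ} {R : Type*} [CommRing R]
    (h2 : ∀ x : R, 2 * x = 0 → x = 0)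
    {φ : MultilinearMap R (fun _ : S2Pair d => Fin d → R) R} (hφ : VanishesOnTriangles φ)
    (c : Fin d) (n : ℕ) : ∀ (g : S2Pair d → Fin d) (u : Fin (2 * d))
      (w : (colourGraph g c).Walk u u), w.IsCycle → w.length = n → colouringValue φ g = 0 := by
  induction n with
  | zero => exact fun g u w hw h0 => absurd (hw.three_le_length) (by omega)
  | succ n ih =>
    intro g x w hw hn
    cases w with
    | nil => simp at hn
    | @cons _ y _ hxy w =>
    obtain ⟨hwp, hxyw⟩ := (SimpleGraph.Walk.cons_isCycle_iff _ _).1 hw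
    cases w with
    | nil => exact absurd rfl hxy.ne
    | @cons _ z _ hyz p =>
    rw [SimpleGraph.Walk.cons_isPath_iff] at hwp
    obtain ⟨hp, hyp⟩ := hwp
    simp only [SimpleGraph.Walk.edges_cons, List.mem_cons, not_or] at hxyw
    have hxz : x ≠ z := by
      rintro rfl
      exact hxyw.1 Sym2.eq_swap
    obtain ⟨nxy, gxy⟩ := colourGraph_adj.1 hxy
    obtain ⟨nyz, gyz⟩ := colourGraph_adj.1 hyz
    obtain ⟨n1, n2, n3⟩ := s2PairOf_triangle_ne nxy hxz nyz
    -- If the chord `xz` has colour `c`, the triangle itself is monochromatic. This includes cycles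
    -- of length three.
    by_cases hb : g (s2PairOf x z hxz) = c
    · exact hφ.eq_zero _ nxy hxz nyz (by rw [gxy, hb]) (by rw [gyz, hb])
    -- Giving the chord `xz` the colour `c` closes the rest `p` of the cycle into a cycle shorter by
    -- one. The path `p` avoids `y` and the edge `xz`, so its colours are unchanged.
    have key : ∀ a b : Fin d, colouringValue φ (recolour g (s2PairOf x y nxy) (s2PairOf x z hxz)
        (s2PairOf y z nyz) a c b) = 0 := by
      intro a b
      set g' := recolour g (s2PairOf x y nxy) (s2PairOf x z hxz) (s2PairOf y z nyz) a c b with hg'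
      have hzx : (colourGraph g' c).Adj x z := by
        rw [colourGraph_adj]
        exact ⟨hxz, by simp [hg', recolour, Function.update_of_ne n3]⟩
      have hy : ∀ e ∈ p.edges, y ∉ e := fun e he hye =>
        hyp (SimpleGraph.Walk.mem_support_of_mem_edges he hye)
      have hxzp : s(x, z) ∉ p.edges := by
        intro h
        have := p.edges_subset_edgeSet h
        rw [SimpleGraph.mem_edgeSet, colourGraph_adj] at this
        exact hb this.2
      have hsub : ∀ e ∈ p.edges, e ∈ (colourGraph g' c).edgeSet := by
        intro e he
        have h1 := p.edges_subset_edgeSet he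
        have h2 := hy e he
        have h3 : e ≠ s(x, z) := fun h => hxzp (h ▸ he)
        induction e with
        | h s t =>
        rw [SimpleGraph.mem_edgeSet, colourGraph_adj] at h1 ⊢
        obtain ⟨hst, h1⟩ := h1
        refine ⟨hst, ?_⟩
        rw [← h1, hg', recolour, Function.update_of_ne, Function.update_of_ne,
          Function.update_of_ne]
        · rw [Ne, s2PairOf_eq_iff]
          rintro h
          exact h2 (h ▸ Sym2.mem_mk_right x y)
        · rwa [Ne, s2PairOf_eq_iff]
        · rw [Ne, s2PairOf_eq_iff]
          rintro h
          exact h2 (h ▸ Sym2.mem_mk_left y z)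
      refine ih g' x (SimpleGraph.Walk.cons hzx (p.transfer _ hsub)) ?_ ?_
      · rw [SimpleGraph.Walk.cons_isCycle_iff, SimpleGraph.Walk.edges_transfer]
        exact ⟨hp.transfer _, hxzp⟩
      · simp only [SimpleGraph.Walk.length_cons, SimpleGraph.Walk.length_transfer] at hn ⊢
        omega
    -- Since `xy` and `yz` share the colour `c`, each arrangement occurs twice. Two of the three
    -- vanish by `key`, leaving twice the value at `g`.
    have hs := hφ.sum_recolour g nxy hxz nyz (fun _ _ _ => rfl) c (g (s2PairOf x z hxz)) c
    rw [key, key] at hs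
    have hself := recolour_self g (s2PairOf x y nxy) (s2PairOf x z hxz) (s2PairOf y z nyz)
    rw [gxy, gyz] at hself
    rw [hself] at hs
    exact h2 _ (by linear_combination hs)

theorem VanishesOnTriangles.isAcyclic {d : ℕ} {R : Type*} [CommRing R]
    (h2 : ∀ x : R, 2 * x = 0 → x = 0)
    {φ : MultilinearMap R (fun _ : S2Pair d => Fin d → R) R} (hφ : VanishesOnTriangles φ)
    {g : S2Pair d → Fin d} (hg : colouringValue φ g ≠ 0) (c : Fin d) :
    (colourGraph g c).IsAcyclic := fun _ w hw =>
  hg (hφ.colouringValue_eq_zero_of_isCycle h2 c _ g _ w hw rfl)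

/-! ### Counting edges -/

theorem edgeSet_colourGraph {d : ℕ} (g : S2Pair d → Fin d) (c : Fin d) :
    (colourGraph g c).edgeSet = (fun p : S2Pair d => s(p.1.1, p.1.2)) '' {p | g p = c} := by
  ext e
  induction e with
  | h u v =>
  rw [SimpleGraph.mem_edgeSet, colourGraph_adj]
  constructor
  · rintro ⟨h, hg⟩
    exact ⟨_, hg, sym2_s2PairOf u v h⟩
  · rintro ⟨p, hp, h⟩
    have huv : u ≠ v := by
      rintro rfl
      have := p.2.ne
      simp only [Sym2.eq_iff] at h
      grind
    exact ⟨huv, by rwa [← S2Pair.sym2_injective (h.trans (sym2_s2PairOf u v huv).symm)]⟩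

theorem ncard_edgeSet_colourGraph {d : ℕ} (g : S2Pair d → Fin d) (c : Fin d) :
    (colourGraph g c).edgeSet.ncard = (Finset.univ.filter fun p => g p = c).card := by
  rw [edgeSet_colourGraph, Set.ncard_image_of_injective _ S2Pair.sym2_injective,
    ← Set.ncard_coe_finset]
  simp

theorem card_s2Pair (d : ℕ) : Fintype.card (S2Pair d) = d * (2 * d - 1) := by
  have h := SimpleGraph.card_edgeFinset_top_eq_card_choose_two (V := Fin (2 * d))
  rw [Fintype.card_fin, Nat.choose_two_right, mul_assoc, Nat.mul_div_cancel_left _ two_pos] at h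
  rw [← h, ← Finset.card_univ, ← Finset.card_image_of_injective _ S2Pair.sym2_injective]
  congr 1
  ext e
  induction e with
  | h u v =>
  simp only [Finset.mem_image, Finset.mem_univ, true_and, SimpleGraph.mem_edgeFinset,
    SimpleGraph.mem_edgeSet, SimpleGraph.top_adj]
  constructor
  · rintro ⟨p, h⟩ rfl
    have := p.2.ne
    simp only [Sym2.eq_iff] at h
    grind
  · exact fun h => ⟨_, sym2_s2PairOf u v h⟩

theorem SimpleGraph.IsAcyclic.exists_isTree_ge {V : Type*} [Nonempty V] {G : SimpleGraph V}
    (hG : G.IsAcyclic) : ∃ T, G ≤ T ∧ T.IsTree := by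
  obtain ⟨T, h, -, hT⟩ := SimpleGraph.connected_top.exists_isTree_le_of_le_of_isAcyclic le_top hG
  exact ⟨T, h, hT⟩

theorem card_filter_le_of_isAcyclic {d : ℕ} {g : S2Pair d → Fin d} {c : Fin d}
    (h : (colourGraph g c).IsAcyclic) :
    (Finset.univ.filter fun p => g p = c).card ≤ 2 * d - 1 := by
  have : Nonempty (Fin (2 * d)) := ⟨⟨0, by have := c.2; omega⟩⟩
  obtain ⟨T, hle, hT⟩ := h.exists_isTree_ge
  have hcard := (SimpleGraph.isTree_iff_connected_and_card.1 hT).2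
  rw [Nat.card_coe_set_eq, Nat.card_eq_fintype_card, Fintype.card_fin] at hcard
  rw [← ncard_edgeSet_colourGraph]
  have := Set.ncard_le_ncard (SimpleGraph.edgeSet_mono hle) (Set.toFinite _)
  omega

/-- If all colour classes are acyclic, they all have the same number of edges. -/
theorem card_filter_eq_of_isAcyclic {d : ℕ} {g : S2Pair d → Fin d}
    (h : ∀ c, (colourGraph g c).IsAcyclic) (c : Fin d) :
    (Finset.univ.filter fun p => g p = c).card = 2 * d - 1 := by
  have hs : ∑ c : Fin d, (Finset.univ.filter fun p => g p = c).card = ∑ _c : Fin d, (2 * d - 1) := by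
    rw [← Finset.card_eq_sum_card_fiberwise (fun _ _ => Finset.mem_univ _), Finset.card_univ,
      card_s2Pair]
    simp
  exact (Finset.sum_eq_sum_iff_of_le fun c _ => card_filter_le_of_isAcyclic (h c)).1 hs c
    (Finset.mem_univ c)

/-- Each class already has as many edges as a spanning tree containing it, so it equals that tree.
-/
theorem connected_colourGraph {d : ℕ} {g : S2Pair d → Fin d}
    (h : ∀ c, (colourGraph g c).IsAcyclic) (c : Fin d) : (colourGraph g c).Connected := by
  have : Nonempty (Fin (2 * d)) := ⟨⟨0, by have := c.2; omega⟩⟩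
  obtain ⟨T, hle, hT⟩ := (h c).exists_isTree_ge
  have hcard := (SimpleGraph.isTree_iff_connected_and_card.1 hT).2
  rw [Nat.card_coe_set_eq, Nat.card_eq_fintype_card, Fintype.card_fin] at hcard
  have hE : (colourGraph g c).edgeSet = T.edgeSet :=
    Set.eq_of_subset_of_ncard_le (SimpleGraph.edgeSet_mono hle) (by
      rw [ncard_edgeSet_colourGraph, card_filter_eq_of_isAcyclic h c]
      omega) (Set.toFinite _)
  rw [SimpleGraph.edgeSet_inj.1 hE]
  exact hT.1

/-! ### The determinant of the weighted incidence matrix -/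

/-- The coefficient of the pair `p` in the balance condition at the vertex `r + 1`. -/
def incidenceCoeff {d : ℕ} (p : S2Pair d) (r : Fin (2 * d - 1)) : ℤ :=
  (if p.1.2.val = r.val + 1 then 1 else 0) - (if p.1.1.val = r.val + 1 then 1 else 0)

/-- A numbering of the pairs by a colour and a vertex different from the first one. -/
noncomputable def s2PairEquiv (d : ℕ) : S2Pair d ≃ Fin d × Fin (2 * d - 1) :=
  Fintype.equivOfCardEq (by rw [card_s2Pair]; simp)

/-- The determinant of the square matrix whose row `p` is the tensor product of the column `v p` with
the row of `p` in the reduced incidence matrix of the complete graph. -/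
noncomputable def incidenceDet (d : ℕ) : MultilinearMap ℤ (fun _ : S2Pair d => Fin d → ℤ) ℤ :=
  (Matrix.detRowAlternating (R := ℤ) (n := S2Pair d)).toMultilinearMap.compLinearMap fun p =>
    LinearMap.pi fun q => incidenceCoeff p (s2PairEquiv d q).2 • LinearMap.proj (s2PairEquiv d q).1

theorem incidenceDet_apply {d : ℕ} (v : S2Pair d → Fin d → ℤ) :
    incidenceDet d v = (Matrix.of fun p q =>
      incidenceCoeff p (s2PairEquiv d q).2 * v p (s2PairEquiv d q).1).det := rfl

theorem vanishesOnTriangles_incidenceDet (d : ℕ) : VanishesOnTriangles (incidenceDet d) := by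
  intro v x y z hxy hyz h1 h2
  rw [incidenceDet_apply, ← Matrix.exists_vecMul_eq_zero_iff]
  -- The relation `(y - x) + (z - y) - (z - x) = 0` between incidence rows survives tensoring with a
  -- common column.
  refine ⟨Pi.single ⟨(x, y), hxy⟩ 1 + Pi.single ⟨(y, z), hyz⟩ 1
    - Pi.single ⟨(x, z), hxy.trans hyz⟩ 1, ?_, ?_⟩
  · intro h
    have := congrFun h ⟨(x, y), hxy⟩
    simp [hxy.ne, hyz.ne] at this
  · rw [Matrix.sub_vecMul, Matrix.add_vecMul]
    funext q
    simp only [Matrix.single_one_vecMul, Pi.sub_apply, Pi.add_apply, Matrix.row, Matrix.of_apply,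
      h1, h2, incidenceCoeff, Pi.zero_apply]
    ring

/-- The incidence determinant is invertible at a colouring with connected colour classes. -/
theorem isUnit_colouringValue_incidenceDet {d : ℕ} {g : S2Pair d → Fin d}
    (hg : ∀ c, (colourGraph g c).Connected) : IsUnit (colouringValue (incidenceDet d) g) := by
  rw [colouringValue, incidenceDet_apply]
  set M : Matrix (S2Pair d) (S2Pair d) ℤ := Matrix.of fun p q =>
    incidenceCoeff p (s2PairEquiv d q).2 * (Pi.single (g p) 1 : Fin d → ℤ) (s2PairEquiv d q).1
    with hM
  rw [← Matrix.isUnit_iff_isUnit_det, ← Matrix.vecMul_surjective_iff_isUnit]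
  -- `b c u` is the basis vector numbered by the colour `c` and the vertex `u`, and zero at the
  -- omitted vertex `0`. Rows are differences of these along edges; telescoping along a walk from
  -- vertex `0` puts every basis vector in the row span.
  let b : Fin d → Fin (2 * d) → S2Pair d → ℤ := fun c u q =>
    if (s2PairEquiv d q).1 = c ∧ u.val = (s2PairEquiv d q).2.val + 1 then 1 else 0
  have hrow : ∀ p, M p = b (g p) p.1.2 - b (g p) p.1.1 := by
    intro p
    funext q
    simp only [hM, b, Matrix.of_apply, incidenceCoeff, Pi.single_apply, Pi.sub_apply]
    split_ifs <;> simp_all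
  let S : Submodule ℤ (S2Pair d → ℤ) := LinearMap.range M.vecMulLinear
  have hMS : ∀ p, M p ∈ S := fun p => ⟨Pi.single p 1, by
    simp [Matrix.row_def]⟩
  have hadj : ∀ c u v, (colourGraph g c).Adj u v → b c v - b c u ∈ S := by
    intro c u v h
    obtain ⟨huv, h⟩ := colourGraph_adj.1 h
    have := hMS (s2PairOf u v huv)
    rw [hrow, h] at this
    unfold s2PairOf at this
    split_ifs at this with hlt
    · exact this
    · rw [← neg_sub]
      exact S.neg_mem this
  have hreach : ∀ c u v, (colourGraph g c).Reachable u v → b c v - b c u ∈ S := by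
    rintro c u v ⟨w⟩
    induction w with
    | nil => simp
    | cons h _ ih => simpa using S.add_mem ih (hadj _ _ _ h)
  have hb : ∀ c u, b c u ∈ S := by
    intro c u
    have h0 : b c ⟨0, by have := c.2; omega⟩ = 0 := by
      funext q
      simp [b]
    simpa [h0] using hreach c ⟨0, by have := c.2; omega⟩ u ((hg c).preconnected _ _)
  have hsingle : ∀ q : S2Pair d, (Pi.single q 1 : S2Pair d → ℤ) ∈ S := by
    intro q
    have hlt : (s2PairEquiv d q).2.val + 1 < 2 * d := by
      have := (s2PairEquiv d q).2.2
      omega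
    convert hb (s2PairEquiv d q).1 ⟨_, hlt⟩ using 1
    funext q'
    simp only [Pi.single_apply, b]
    congr 1
    rw [← (s2PairEquiv d).injective.eq_iff, Prod.ext_iff, Fin.ext_iff (a := (s2PairEquiv d q').2)]
    simp only [add_left_inj, eq_comm]
  intro y
  have : y ∈ S := by
    rw [← (Pi.basisFun ℤ (S2Pair d)).sum_repr y]
    exact S.sum_mem fun q _ => S.smul_mem _ (by simpa using hsingle q)
  exact this

/-- The colour classes of the distinguished colouring are connected. -/
theorem connected_colourGraph_s2Index {d : ℕ} (c : Fin d) :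
    (colourGraph (s2Index (d := d)) c).Connected := by
  have hc := c.2
  have hadj : ∀ u v : Fin (2 * d), u < v →
      (if Even (u.val + v.val) then u.val / 2 else v.val / 2) = c.val →
      (colourGraph (s2Index (d := d)) c).Adj u v := by
    intro u v huv h
    rw [colourGraph_adj]
    refine ⟨huv.ne, ?_⟩
    rw [s2PairOf_of_lt huv, Fin.ext_iff, ← h, s2Index]
    split_ifs <;> rfl
  -- The class is a double star with central edge `AB`; the parity of any other vertex and its side
  -- of the block decide which centre it is joined to.
  let A : Fin (2 * d) := ⟨2 * c.val, by omega⟩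
  let B : Fin (2 * d) := ⟨2 * c.val + 1, by omega⟩
  have hAB : (colourGraph (s2Index (d := d)) c).Adj A B := by
    apply hadj
    · simp [A, B, Fin.lt_def]
    · simp only [A, B, Nat.even_iff]
      split_ifs <;> omega
  have key : ∀ u, (colourGraph (s2Index (d := d)) c).Reachable A u := by
    intro u
    rcases lt_trichotomy u A with h | rfl | h
    · rcases Nat.even_or_odd u.val with hu | hu
      · refine hAB.reachable.trans (hadj u B ?_ ?_).symm.reachable
        · simp only [A, B, Fin.lt_def] at h ⊢
          omega
        · simp only [B, Nat.even_iff] at hu ⊢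
          split_ifs <;> omega
      · refine (hadj u A h ?_).symm.reachable
        simp only [A, Nat.even_iff, Nat.odd_iff] at hu ⊢
        split_ifs <;> omega
    · exact .refl _
    · rcases Nat.even_or_odd u.val with hu | hu
      · refine (hadj A u h ?_).reachable
        simp only [A, Nat.even_iff] at hu ⊢
        split_ifs <;> omega
      · by_cases hB : u = B
        · exact hB ▸ hAB.reachable
        · refine hAB.reachable.trans (hadj B u ?_ ?_).reachable
          · simp only [A, B, Fin.lt_def, Fin.ext_iff] at h hB ⊢
            omega
          · simp only [B, Nat.even_iff, Nat.odd_iff] at hu ⊢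
            split_ifs <;> omega
  have : Nonempty (Fin (2 * d)) := ⟨A⟩
  exact ⟨fun u v => (key u).symm.trans (key v)⟩

theorem Int.two_mul_eq_zero_imp (x : ℤ) (h : 2 * x = 0) : x = 0 := by omega

/-- Connectedness makes the incidence determinant a unit, whereas a monochromatic cycle would make
it zero. -/
theorem isAcyclic_of_connected_colourGraph {d : ℕ} {g : S2Pair d → Fin d}
    (hg : ∀ c, (colourGraph g c).Connected) (c : Fin d) : (colourGraph g c).IsAcyclic :=
  (vanishesOnTriangles_incidenceDet d).isAcyclic Int.two_mul_eq_zero_imp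
    (isUnit_colouringValue_incidenceDet hg).ne_zero c

theorem isAcyclic_colourGraph_s2Index {d : ℕ} (c : Fin d) :
    (colourGraph (s2Index (d := d)) c).IsAcyclic :=
  isAcyclic_of_connected_colourGraph connected_colourGraph_s2Index c

theorem isUnit_colouringValue_of_ne_zero {d : ℕ} {g : S2Pair d → Fin d}
    (hg : colouringValue (incidenceDet d) g ≠ 0) : IsUnit (colouringValue (incidenceDet d) g) :=
  isUnit_colouringValue_incidenceDet <| connected_colourGraph <|
    (vanishesOnTriangles_incidenceDet d).isAcyclic Int.two_mul_eq_zero_imp hg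

/-! ### The value at upper triangular matrices -/

theorem sum_val_eq_of_isAcyclic {d : ℕ} {g : S2Pair d → Fin d}
    (h : ∀ c, (colourGraph g c).IsAcyclic) :
    ∑ p, (g p).val = ∑ c : Fin d, (2 * d - 1) * c.val := by
  rw [← Finset.sum_fiberwise Finset.univ g]
  refine Finset.sum_congr rfl fun c _ => ?_
  rw [Finset.sum_congr rfl (g := fun _ => c.val), Finset.sum_const, smul_eq_mul,
    card_filter_eq_of_isAcyclic h]
  intro p hp
  rw [(Finset.mem_filter.1 hp).2]

theorem MultilinearMap.eq_sum_colouringValue {d : ℕ} {R : Type*} [CommRing R]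
    (φ : MultilinearMap R (fun _ : S2Pair d => Fin d → R) R) (v : S2Pair d → Fin d → R) :
    φ v = ∑ g : S2Pair d → Fin d, (∏ p, v p (g p)) * colouringValue φ g := by
  have hv : v = fun p => ∑ l : Fin d, v p l • (Pi.single l 1 : Fin d → R) := by
    funext p
    exact pi_eq_sum_univ' (v p)
  conv_lhs => rw [hv]
  rw [φ.map_sum]
  refine Finset.sum_congr rfl fun g _ => ?_
  rw [φ.map_smul_univ, smul_eq_mul, colouringValue]

/-- A colouring exceeding `s2Index` somewhere meets a zero entry. One that stays below it and has
nonzero value has the same sum of colours as `s2Index`, hence equals it. -/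
theorem VanishesOnTriangles.apply_of_upperTriangular {d : ℕ} {R : Type*} [CommRing R]
    (h2 : ∀ x : R, 2 * x = 0 → x = 0)
    {φ : MultilinearMap R (fun _ : S2Pair d => Fin d → R) R} (hφ : VanishesOnTriangles φ)
    {v : S2Pair d → Fin d → R} (hv : ∀ p l, s2Index p < l → v p l = 0) :
    φ v = colouringValue φ s2Index * ∏ p, v p (s2Index p) := by
  rw [φ.eq_sum_colouringValue, Finset.sum_eq_single s2Index, mul_comm]
  · intro g _ hg
    by_cases hle : ∀ p, g p ≤ s2Index p
    · by_cases h0 : colouringValue φ g = 0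
      · rw [h0, mul_zero]
      · exfalso
        apply hg
        have hs := (sum_val_eq_of_isAcyclic (hφ.isAcyclic h2 h0)).trans
          (sum_val_eq_of_isAcyclic (isAcyclic_colourGraph_s2Index (d := d))).symm
        funext p
        exact Fin.ext ((Finset.sum_eq_sum_iff_of_le fun p _ => Fin.le_def.1 (hle p)).1 hs p
          (Finset.mem_univ p))
    · push Not at hle
      obtain ⟨p, hp⟩ := hle
      rw [Finset.prod_eq_zero (Finset.mem_univ p) (hv p _ hp), zero_mul]
  · exact fun h => absurd (Finset.mem_univ _) h

/-! ### Recolouring a triangle -/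

/-- A connected graph arising from `F` by the edge `x y`, an acyclic one arising by `x z` and an
acyclic one arising by `y z` do not coexist. -/
theorem SimpleGraph.false_of_triangle_completions {V : Type*} {F G₁ G₂ G₃ : SimpleGraph V}
    {x y z : V} (h₁ : G₁.Connected)
    (hG₁ : ∀ u v, G₁.Adj u v → F.Adj u v ∨ s(u, v) = s(x, y))
    (h₂ : G₂.IsAcyclic) (hxz : G₂.Adj x z) (hF₂ : F ≤ G₂.deleteEdges {s(x, z)})
    (h₃ : G₃.IsAcyclic) (hyz : G₃.Adj y z) (hF₃ : F ≤ G₃.deleteEdges {s(y, z)}) : False := by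
  have hxz' : ¬F.Reachable x z := fun h =>
    isBridge_iff.1 (isAcyclic_iff_forall_adj_isBridge.1 h₂ hxz) (h.mono hF₂)
  have hyz' : ¬F.Reachable y z := fun h =>
    isBridge_iff.1 (isAcyclic_iff_forall_adj_isBridge.1 h₃ hyz) (h.mono hF₃)
  -- Following a walk to `x` until it first uses the edge `xy` shows that `F` has only the
  -- components of `x` and `y`. The vertex `z` lies in one of them, which `hxz'` and `hyz'` forbid.
  have key : ∀ u w, G₁.Walk u w → w = x → F.Reachable u x ∨ F.Reachable u y := by
    intro u w p
    induction p with
    | nil =>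
      rintro rfl
      exact .inl (.refl _)
    | @cons u v w h _ ih =>
      intro hw
      rcases hG₁ _ _ h with h | h
      · exact (ih hw).imp h.reachable.trans h.reachable.trans
      · rcases Sym2.eq_iff.1 h with ⟨rfl, -⟩ | ⟨rfl, -⟩
        · exact .inl (.refl _)
        · exact .inr (.refl _)
  obtain ⟨w⟩ := h₁.preconnected z x
  exact (key z x w rfl).elim (fun h => hxz' h.symm) fun h => hyz' h.symm

section Recolour

variable {d : ℕ} (g : S2Pair d → Fin d) {p q r : S2Pair d} (a b c : Fin d)

theorem recolour_snd (hqr : q ≠ r) : recolour g p q r a b c q = b := by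
  simp [recolour, hqr]

theorem recolour_trd : recolour g p q r a b c r = c := by
  simp [recolour]

theorem recolour_of_ne {s : S2Pair d} (hp : s ≠ p) (hq : s ≠ q) (hr : s ≠ r) :
    recolour g p q r a b c s = g s := by
  simp [recolour, hp, hq, hr]

variable {g} in
theorem eq_recolour {g' : S2Pair d → Fin d} (h : ∀ s, s ≠ p → s ≠ q → s ≠ r → g' s = g s) :
    g' = recolour g p q r (g' p) (g' q) (g' r) := by
  funext s
  simp only [recolour, Function.update_apply]
  split_ifs with h1 h2 h3
  · rw [h1]
  · rw [h2]
  · rw [h3]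
  · exact h s h3 h2 h1

end Recolour

/-- A colour used once on the triangle cannot complete the same outside forest to a spanning tree at
all three edges. This limits how many terms of the six-term relation are nonzero. -/
theorem exists_not_ne_zero_of_alone {d : ℕ} (g : S2Pair d → Fin d) {x y z : Fin (2 * d)}
    (hxy : x ≠ y) (hxz : x ≠ z) (hyz : y ≠ z) {T : Fin d → Fin d → Fin d → ℤ}
    (hT : ∀ a b c, T a b c = colouringValue (incidenceDet d)
      (recolour g (s2PairOf x y hxy) (s2PairOf x z hxz) (s2PairOf y z hyz) a b c)) (α : Fin d) :
    (∀ b c, b ≠ α → c ≠ α → T α b c = 0) ∨ (∀ a c, a ≠ α → c ≠ α → T a α c = 0) ∨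
      ∀ a b, a ≠ α → b ≠ α → T a b α = 0 := by
  by_contra! h
  obtain ⟨⟨b₁, c₁, hb₁, hc₁, h₁⟩, ⟨a₂, c₂, ha₂, hc₂, h₂⟩, ⟨a₃, b₃, ha₃, hb₃, h₃⟩⟩ := h
  rw [hT] at h₁ h₂ h₃
  obtain ⟨n1, n2, n3⟩ := s2PairOf_triangle_ne hxy hxz hyz
  have hac {g' : S2Pair d → Fin d} (h : colouringValue (incidenceDet d) g' ≠ 0) :=
    (vanishesOnTriangles_incidenceDet d).isAcyclic Int.two_mul_eq_zero_imp h
  have hF : ∀ a b c, (colourGraph g α).deleteEdges {s(x, y), s(x, z), s(y, z)} =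
      (colourGraph (recolour g (s2PairOf x y hxy) (s2PairOf x z hxz) (s2PairOf y z hyz) a b c)
        α).deleteEdges {s(x, y), s(x, z), s(y, z)} := by
    intro a b c
    ext u v
    simp only [SimpleGraph.deleteEdges_adj, Set.mem_insert_iff, Set.mem_singleton_iff, not_or,
      and_congr_left_iff, colourGraph_adj]
    rintro ⟨k1, k2, k3⟩
    refine exists_congr fun huv => ?_
    rw [recolour_of_ne] <;> rwa [Ne, s2PairOf_eq_iff]
  refine SimpleGraph.false_of_triangle_completions
    (F := (colourGraph g α).deleteEdges {s(x, y), s(x, z), s(y, z)}) (x := x) (y := y) (z := z)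
    (connected_colourGraph (hac h₁) α) ?_ (hac h₂ α) ?_ ?_ (hac h₃ α) ?_ ?_
  · intro u v huv
    rw [hF α b₁ c₁, SimpleGraph.deleteEdges_adj]
    by_cases k1 : s(u, v) = s(x, y)
    · exact .inr k1
    obtain ⟨nuv, hα⟩ := colourGraph_adj.1 huv
    refine .inl ⟨huv, ?_⟩
    simp only [Set.mem_insert_iff, Set.mem_singleton_iff, not_or]
    refine ⟨k1, fun k => ?_, fun k => ?_⟩
    · rw [s2PairOf_eq_iff (h' := hxz) |>.2 k, recolour_snd _ _ _ _ n3] at hα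
      exact hb₁ hα
    · rw [s2PairOf_eq_iff (h' := hyz) |>.2 k, recolour_trd] at hα
      exact hc₁ hα
  · exact colourGraph_adj.2 ⟨hxz, recolour_snd _ _ _ _ n3⟩
  · rw [hF a₂ α c₂]
    exact SimpleGraph.deleteEdges_anti (by simp)
  · exact colourGraph_adj.2 ⟨hyz, recolour_trd _ _ _ _⟩
  · rw [hF a₃ b₃ α]
    exact SimpleGraph.deleteEdges_anti (by simp)

theorem Fintype.prod_eq_mul_mul_prod_compl {ι M : Type*} [Fintype ι] [DecidableEq ι] [CommMonoid M]
    {p q r : ι} (hpq : p ≠ q) (hpr : p ≠ r) (hqr : q ≠ r) (f : ι → M) :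
    ∏ i, f i = f p * f q * f r * ∏ i ∈ ({p, q, r} : Finset ι)ᶜ, f i := by
  rw [← Finset.prod_mul_prod_compl {p, q, r}, Finset.prod_insert (by simp [hpq, hpr]),
    Finset.prod_insert (by simpa using hqr), Finset.prod_singleton]
  simp only [mul_assoc]

theorem eq_perm_of_ite_count {α : Type*} [DecidableEq α] {a b c a' b' c' : α}
    (h : ∀ x, (if a' = x then 1 else 0) + (if b' = x then 1 else 0) + (if c' = x then 1 else 0) =
      (if a = x then 1 else 0) + (if b = x then 1 else 0) + (if c = x then 1 else 0)) :
    (a' = a ∧ b' = b ∧ c' = c) ∨ (a' = a ∧ b' = c ∧ c' = b) ∨ (a' = b ∧ b' = a ∧ c' = c) ∨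
      (a' = b ∧ b' = c ∧ c' = a) ∨ (a' = c ∧ b' = a ∧ c' = b) ∨ (a' = c ∧ b' = b ∧ c' = a) := by
  have h1 := h a
  have h2 := h b
  have h3 := h c
  clear h
  grind (splits := 30)

/-- Two acyclic colourings which agree outside a triangle use the same colours on the triangle. -/
theorem perm_of_isAcyclic_of_agree {d : ℕ} {g g' : S2Pair d → Fin d}
    (hg : ∀ c, (colourGraph g c).IsAcyclic) (hg' : ∀ c, (colourGraph g' c).IsAcyclic)
    {p q r : S2Pair d} (hpq : p ≠ q) (hpr : p ≠ r) (hqr : q ≠ r)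
    (h : ∀ s, s ≠ p → s ≠ q → s ≠ r → g' s = g s) :
    (g' p = g p ∧ g' q = g q ∧ g' r = g r) ∨ (g' p = g p ∧ g' q = g r ∧ g' r = g q) ∨
      (g' p = g q ∧ g' q = g p ∧ g' r = g r) ∨ (g' p = g q ∧ g' q = g r ∧ g' r = g p) ∨
      (g' p = g r ∧ g' q = g p ∧ g' r = g q) ∨ (g' p = g r ∧ g' q = g q ∧ g' r = g p) := by
  apply eq_perm_of_ite_count
  intro α
  have h1 := card_filter_eq_of_isAcyclic hg α
  rw [← card_filter_eq_of_isAcyclic hg' α, Finset.card_filter, Finset.card_filter] at h1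
  -- Both colourings use each colour `2d - 1` times; removing the common part outside the triangle
  -- leaves equal multiplicities on it.
  have split (f : S2Pair d → ℕ) : ∑ i, f i = f p + f q + f r + ∑ i ∈ ({p, q, r} : Finset _)ᶜ, f i :=
    Fintype.prod_eq_mul_mul_prod_compl (M := Multiplicative ℕ) hpq hpr hqr f
  rw [split, split] at h1
  have h2 : ∑ i ∈ ({p, q, r} : Finset _)ᶜ, (if g i = α then 1 else 0) =
      ∑ i ∈ ({p, q, r} : Finset _)ᶜ, (if g' i = α then 1 else 0) := by
    refine Finset.sum_congr rfl fun s hs => ?_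
    simp only [Finset.mem_compl, Finset.mem_insert, Finset.mem_singleton, not_or] at hs
    rw [h s hs.1 hs.2.1 hs.2.2]
  rw [h2] at h1
  exact (Nat.add_right_cancel h1).symm

/-- The incidence determinant changes sign between two different acyclic colourings which agree
outside a triangle. -/
theorem colouringValue_incidenceDet_eq_neg {d : ℕ} {g g' : S2Pair d → Fin d}
    (hg : colouringValue (incidenceDet d) g ≠ 0) (hg' : colouringValue (incidenceDet d) g' ≠ 0)
    (hne : g' ≠ g) {x y z : Fin (2 * d)} (hxy : x ≠ y) (hxz : x ≠ z) (hyz : y ≠ z)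
    (h : ∀ s, s ≠ s2PairOf x y hxy → s ≠ s2PairOf x z hxz → s ≠ s2PairOf y z hyz → g' s = g s) :
    colouringValue (incidenceDet d) g' = -colouringValue (incidenceDet d) g := by
  obtain ⟨n1, n2, n3⟩ := s2PairOf_triangle_ne hxy hxz hyz
  have hac {g' : S2Pair d → Fin d} (h : colouringValue (incidenceDet d) g' ≠ 0) :=
    (vanishesOnTriangles_incidenceDet d).isAcyclic Int.two_mul_eq_zero_imp h
  have hperm := perm_of_isAcyclic_of_agree (hac hg) (hac hg') n1 n2 n3 h
  have hg'r := eq_recolour h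
  have hgr := recolour_self g (s2PairOf x y hxy) (s2PairOf x z hxz) (s2PairOf y z hyz)
  obtain ⟨T, hT⟩ : ∃ T : Fin d → Fin d → Fin d → ℤ, ∀ a b c, T a b c =
      colouringValue (incidenceDet d) (recolour g (s2PairOf x y hxy) (s2PairOf x z hxz)
        (s2PairOf y z hyz) a b c) := ⟨_, fun _ _ _ => rfl⟩
  generalize g (s2PairOf x y hxy) = a at *
  generalize g (s2PairOf x z hxz) = b at *
  generalize g (s2PairOf y z hyz) = c at *
  generalize g' (s2PairOf x y hxy) = a' at *
  generalize g' (s2PairOf x z hxz) = b' at *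
  generalize g' (s2PairOf y z hyz) = c' at *
  have hsum := (vanishesOnTriangles_incidenceDet d).sum_recolour g hxy hxz hyz hT a b c
  have hunit : ∀ a b c, T a b c = 0 ∨ T a b c = 1 ∨ T a b c = -1 := fun a b c => by
    rw [hT, or_iff_not_imp_left]
    exact fun h => Int.isUnit_iff.1 (isUnit_colouringValue_of_ne_zero h)
  have hne' : ¬(a' = a ∧ b' = b ∧ c' = c) := by
    rintro ⟨rfl, rfl, rfl⟩
    exact hne (hg'r.trans hgr)
  have ea := exists_not_ne_zero_of_alone g hxy hxz hyz hT a
  have eb := exists_not_ne_zero_of_alone g hxy hxz hyz hT b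
  have ec := exists_not_ne_zero_of_alone g hxy hxz hyz hT c
  have hgT : colouringValue (incidenceDet d) g = T a b c := by rw [hT, hgr]
  rw [hg'r, ← hT] at hg' ⊢
  rw [hgT] at hg ⊢
  clear hg'r hgr hgT h hne hT hac
  -- With a repeated colour the relation reduces to three values in `{0, 1, -1}` with sum zero, so
  -- two nonzero ones are opposite.
  by_cases hab : a = b
  · subst hab
    have h1 := hunit a a c
    have h2 := hunit a c a
    have h3 := hunit c a a
    rcases hperm with ⟨rfl, rfl, rfl⟩ | ⟨rfl, rfl, rfl⟩ | ⟨rfl, rfl, rfl⟩ | ⟨rfl, rfl, rfl⟩ |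
      ⟨rfl, rfl, rfl⟩ | ⟨rfl, rfl, rfl⟩ <;> first | (exact absurd ⟨rfl, rfl, rfl⟩ hne') | omega
  by_cases hac : a = c
  · subst hac
    have h1 := hunit a a b
    have h2 := hunit a b a
    have h3 := hunit b a a
    rcases hperm with ⟨rfl, rfl, rfl⟩ | ⟨rfl, rfl, rfl⟩ | ⟨rfl, rfl, rfl⟩ | ⟨rfl, rfl, rfl⟩ |
      ⟨rfl, rfl, rfl⟩ | ⟨rfl, rfl, rfl⟩ <;> first | (exact absurd ⟨rfl, rfl, rfl⟩ hne') | omega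
  by_cases hbc : b = c
  · subst hbc
    have h1 := hunit a b b
    have h2 := hunit b a b
    have h3 := hunit b b a
    rcases hperm with ⟨rfl, rfl, rfl⟩ | ⟨rfl, rfl, rfl⟩ | ⟨rfl, rfl, rfl⟩ | ⟨rfl, rfl, rfl⟩ |
      ⟨rfl, rfl, rfl⟩ | ⟨rfl, rfl, rfl⟩ <;> first | (exact absurd ⟨rfl, rfl, rfl⟩ hne') | omega
  have hba := Ne.symm hab
  have hca := Ne.symm hac
  have hcb := Ne.symm hbc
  -- With distinct colours, each colour is excluded from some edge of the triangle. At most two of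
  -- the six arrangements avoid all three exclusions, and their values sum to zero.
  have ea' : (T a b c = 0 ∧ T a c b = 0) ∨ (T b a c = 0 ∧ T c a b = 0) ∨
      (T b c a = 0 ∧ T c b a = 0) := by
    refine ea.imp (fun h => ?_) (Or.imp (fun h => ?_) fun h => ?_) <;>
      exact ⟨h _ _ ‹_› ‹_›, h _ _ ‹_› ‹_›⟩
  have eb' : (T b a c = 0 ∧ T b c a = 0) ∨ (T a b c = 0 ∧ T c b a = 0) ∨
      (T a c b = 0 ∧ T c a b = 0) := by
    refine eb.imp (fun h => ?_) (Or.imp (fun h => ?_) fun h => ?_) <;>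
      exact ⟨h _ _ ‹_› ‹_›, h _ _ ‹_› ‹_›⟩
  have ec' : (T c a b = 0 ∧ T c b a = 0) ∨ (T a c b = 0 ∧ T b c a = 0) ∨
      (T a b c = 0 ∧ T b a c = 0) := by
    refine ec.imp (fun h => ?_) (Or.imp (fun h => ?_) fun h => ?_) <;>
      exact ⟨h _ _ ‹_› ‹_›, h _ _ ‹_› ‹_›⟩
  clear ea eb ec hunit
  rcases hperm with ⟨rfl, rfl, rfl⟩ | ⟨rfl, rfl, rfl⟩ | ⟨rfl, rfl, rfl⟩ | ⟨rfl, rfl, rfl⟩ |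
    ⟨rfl, rfl, rfl⟩ | ⟨rfl, rfl, rfl⟩ <;> first | (exact absurd ⟨rfl, rfl, rfl⟩ hne') | omega

/-- An acyclic colouring can be changed on every triangle. -/
theorem exists_ne_of_triangle {d : ℕ} {g : S2Pair d → Fin d}
    (hg : colouringValue (incidenceDet d) g ≠ 0) {x y z : Fin (2 * d)} (hxy : x ≠ y) (hxz : x ≠ z)
    (hyz : y ≠ z) : ∃ g', g' ≠ g ∧ colouringValue (incidenceDet d) g' ≠ 0 ∧
      ∀ s, s ≠ s2PairOf x y hxy → s ≠ s2PairOf x z hxz → s ≠ s2PairOf y z hyz → g' s = g s := by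
  by_contra! hcon
  -- Without another colouring, the six-term relation would read `m` times the value at `g` equals
  -- zero with `1 ≤ m ≤ 6`, impossible over `ℤ`.
  have hT : ∀ a b c, colouringValue (incidenceDet d) (recolour g (s2PairOf x y hxy)
      (s2PairOf x z hxz) (s2PairOf y z hyz) a b c) = 0 ∨ colouringValue (incidenceDet d)
        (recolour g (s2PairOf x y hxy) (s2PairOf x z hxz) (s2PairOf y z hyz) a b c) =
          colouringValue (incidenceDet d) g := by
    intro a b c
    by_cases h : recolour g (s2PairOf x y hxy) (s2PairOf x z hxz) (s2PairOf y z hyz) a b c = g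
    · exact .inr (congrArg _ h)
    · refine .inl (by_contra fun h0 => ?_)
      obtain ⟨s, h1, h2, h3, h4⟩ := hcon _ h h0
      exact h4 (recolour_of_ne g a b c h1 h2 h3)
  have hsum := (vanishesOnTriangles_incidenceDet d).sum_recolour g hxy hxz hyz (fun _ _ _ => rfl)
    (g (s2PairOf x y hxy)) (g (s2PairOf x z hxz)) (g (s2PairOf y z hyz))
  generalize hA : g (s2PairOf x y hxy) = A at hsum
  generalize hB : g (s2PairOf x z hxz) = B at hsum
  generalize hC : g (s2PairOf y z hyz) = C at hsum
  have hself : colouringValue (incidenceDet d) (recolour g (s2PairOf x y hxy) (s2PairOf x z hxz)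
      (s2PairOf y z hyz) A B C) = colouringValue (incidenceDet d) g := by
    rw [← hA, ← hB, ← hC, recolour_self]
  have h1 := hT A C B
  have h2 := hT B A C
  have h3 := hT B C A
  have h4 := hT C A B
  have h5 := hT C B A
  omega

/-! ### Homogeneous cycle-free partitions as colourings -/

namespace HCFPartition

variable {d : ℕ}

theorem existsUnique_adj (Γ : HCFPartition d) (p : S2Pair d) :
    ∃! c, (Γ.1 c).Adj p.1.1 p.1.2 := by
  have h : s(p.1.1, p.1.2) ∈ ⋃ i, (Γ.1 i).edgeSet := by
    rw [Γ.2.union]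
    exact p.2.ne
  obtain ⟨c, hc⟩ := Set.mem_iUnion.1 h
  refine ⟨c, hc, fun c' (hc' : s(p.1.1, p.1.2) ∈ (Γ.1 c').edgeSet) => ?_⟩
  by_contra hne
  rcases lt_or_gt_of_ne hne with hlt | hlt
  · exact Set.eq_empty_iff_forall_notMem.1 (Γ.2.disjoint _ _ hlt) _ ⟨hc', hc⟩
  · exact Set.eq_empty_iff_forall_notMem.1 (Γ.2.disjoint _ _ hlt) _ ⟨hc, hc'⟩

/-- The colouring of the edges given by a partition. -/
noncomputable def colour (Γ : HCFPartition d) (p : S2Pair d) : Fin d :=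
  (Γ.existsUnique_adj p).choose

theorem adj_iff_colour_eq (Γ : HCFPartition d) {p : S2Pair d} {c : Fin d} :
    (Γ.1 c).Adj p.1.1 p.1.2 ↔ Γ.colour p = c :=
  ⟨fun h => ((Γ.existsUnique_adj p).choose_spec.2 c h).symm,
    fun h => h ▸ (Γ.existsUnique_adj p).choose_spec.1⟩

theorem colourGraph_colour (Γ : HCFPartition d) (c : Fin d) :
    colourGraph Γ.colour c = Γ.1 c := by
  ext u v
  rcases lt_trichotomy u v with h | rfl | h
  · exact (colourGraph_adj_pair (p := ⟨(u, v), h⟩)).trans Γ.adj_iff_colour_eq.symm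
  · simp
  · rw [SimpleGraph.adj_comm, (Γ.1 c).adj_comm]
    exact (colourGraph_adj_pair (p := ⟨(v, u), h⟩)).trans Γ.adj_iff_colour_eq.symm

theorem colour_injective : Function.Injective (colour (d := d)) := fun Γ Λ h =>
  Subtype.ext <| funext fun c => by rw [← colourGraph_colour, h, colourGraph_colour]

theorem isAcyclic_colourGraph_colour (Γ : HCFPartition d) (c : Fin d) :
    (colourGraph Γ.colour c).IsAcyclic := by
  rw [colourGraph_colour]
  exact Γ.2.cycleFree c

theorem isUnit_colouringValue (Γ : HCFPartition d) :
    IsUnit (colouringValue (incidenceDet d) Γ.colour) :=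
  isUnit_colouringValue_incidenceDet (connected_colourGraph Γ.isAcyclic_colourGraph_colour)

/-- Homogeneity is automatic: `d` forests covering `K_{2d}` must all be spanning trees. -/
theorem _root_.isHCFPartition_colourGraph {g : S2Pair d → Fin d}
    (hg : ∀ c, (colourGraph g c).IsAcyclic) : IsHCFPartition (colourGraph g) where
  disjoint i j hij := by
    simp only [edgeSet_colourGraph]
    rw [← Set.image_inter S2Pair.sym2_injective, Set.image_eq_empty]
    ext p
    simp only [Set.mem_inter_iff, Set.mem_ofPred_eq, Set.mem_empty_iff_false, iff_false]
    rintro ⟨h, h'⟩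
    exact hij.ne (h.symm.trans h')
  union := by
    ext e
    induction e with
    | h u v =>
    simp only [Set.mem_iUnion, SimpleGraph.mem_edgeSet, SimpleGraph.top_adj, colourGraph_adj]
    exact ⟨fun ⟨_, h, _⟩ => h, fun h => ⟨_, h, rfl⟩⟩
  cycleFree := hg
  homogeneous i j _ := by
    simp only [ncard_edgeSet_colourGraph, card_filter_eq_of_isAcyclic hg]

theorem colour_mk_colourGraph {g : S2Pair d → Fin d} (h : IsHCFPartition (colourGraph g)) :
    colour ⟨colourGraph g, h⟩ = g := funext fun _ =>
  (adj_iff_colour_eq ⟨colourGraph g, h⟩).1 (colourGraph_adj_pair.2 rfl)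

theorem isInvolutionOf_iff (Γ Λ : HCFPartition d) {x y z : Fin (2 * d)} (hxy : x ≠ y) (hxz : x ≠ z)
    (hyz : y ≠ z) : IsInvolutionOf Γ Λ x y z ↔ Λ ≠ Γ ∧ ∀ s, s ≠ s2PairOf x y hxy →
      s ≠ s2PairOf x z hxz → s ≠ s2PairOf y z hyz → Λ.colour s = Γ.colour s := by
  refine and_congr_right fun _ => ⟨fun h s h1 h2 h3 => ?_, fun h c e h1 h2 h3 => ?_⟩
  · rw [← adj_iff_colour_eq]
    rw [S2Pair.eq_s2PairOf s, Ne, s2PairOf_eq_iff] at h1 h2 h3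
    exact (h (Γ.colour s) s(s.1.1, s.1.2) h1 h2 h3).2 (Γ.adj_iff_colour_eq.2 rfl)
  · induction e with
    | h u v =>
    rw [SimpleGraph.mem_edgeSet, SimpleGraph.mem_edgeSet, ← colourGraph_colour,
      ← colourGraph_colour, colourGraph_adj, colourGraph_adj]
    refine exists_congr fun huv => ?_
    rw [h] <;> rwa [Ne, s2PairOf_eq_iff]

open Classical in
theorem s2Monomial_eq {k : Type*} [Field k] (Γ : HCFPartition d) (v : S2Pair d → Fin d → k) :
    s2Monomial Γ.1 v = ∏ p, v p (Γ.colour p) := by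
  rw [s2Monomial, ← Finset.prod_fiberwise Finset.univ Γ.colour]
  refine Finset.prod_congr rfl fun c _ => ?_
  simp only [adj_iff_colour_eq]
  refine Finset.prod_congr rfl fun p hp => ?_
  rw [(Finset.mem_filter.1 hp).2]

/-- The monomials of two partitions which agree outside a triangle have the same value when the
columns of the triangle are equal. -/
theorem prod_eq_of_agree {k : Type*} [Field k] (Γ Λ : HCFPartition d) {p q r : S2Pair d}
    (hpq : p ≠ q) (hpr : p ≠ r) (hqr : q ≠ r)
    (h : ∀ s, s ≠ p → s ≠ q → s ≠ r → Λ.colour s = Γ.colour s) {v : S2Pair d → Fin d → k}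
    (h1 : v p = v q) (h2 : v q = v r) :
    ∏ s, v s (Λ.colour s) = ∏ s, v s (Γ.colour s) := by
  rw [Fintype.prod_eq_mul_mul_prod_compl hpq hpr hqr,
    Fintype.prod_eq_mul_mul_prod_compl hpq hpr hqr, h1, h2]
  congr 1
  · rcases perm_of_isAcyclic_of_agree Γ.isAcyclic_colourGraph_colour
      Λ.isAcyclic_colourGraph_colour hpq hpr hqr h with ⟨e1, e2, e3⟩ | ⟨e1, e2, e3⟩ |
      ⟨e1, e2, e3⟩ | ⟨e1, e2, e3⟩ | ⟨e1, e2, e3⟩ | ⟨e1, e2, e3⟩ <;> rw [e1, e2, e3] <;> ring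
  · refine Finset.prod_congr rfl fun s hs => ?_
    simp only [Finset.mem_compl, Finset.mem_insert, Finset.mem_singleton, not_or] at hs
    rw [h s hs.1 hs.2.1 hs.2.2]

theorem exists_agree (Γ : HCFPartition d) {x y z : Fin (2 * d)} (hxy : x ≠ y) (hxz : x ≠ z)
    (hyz : y ≠ z) : ∃ Λ : HCFPartition d, Λ ≠ Γ ∧ ∀ s, s ≠ s2PairOf x y hxy →
      s ≠ s2PairOf x z hxz → s ≠ s2PairOf y z hyz → Λ.colour s = Γ.colour s := by
  obtain ⟨g, hne, hg, h⟩ := exists_ne_of_triangle Γ.isUnit_colouringValue.ne_zero hxy hxz hyz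
  have hH := isHCFPartition_colourGraph
    ((vanishesOnTriangles_incidenceDet d).isAcyclic Int.two_mul_eq_zero_imp hg)
  refine ⟨⟨colourGraph g, hH⟩, fun he => hne ?_, ?_⟩
  · rw [← he, colour_mk_colourGraph]
  · rwa [colour_mk_colourGraph]

/-- The partition given by the distinguished tensor. -/
def identity (d : ℕ) : HCFPartition d :=
  ⟨s2EPartition d, isHCFPartition_colourGraph isAcyclic_colourGraph_s2Index⟩

theorem colour_identity : (identity d).colour = s2Index :=
  colour_mk_colourGraph (isHCFPartition_colourGraph isAcyclic_colourGraph_s2Index)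

end HCFPartition

/-! ### The sign map and the signed sum -/

theorem exists_isS2Sign (d : ℕ) : ∃ ε : HCFPartition d → ℤˣ, IsS2Sign ε := by
  let δ : HCFPartition d → ℤˣ := fun Γ => Γ.isUnit_colouringValue.unit
  -- The constant factor enforces the normalization, since `δ` squares to one.
  refine ⟨fun Γ => δ (HCFPartition.identity d) * (-1) ^ (d + 1) * δ Γ, ?_, ?_⟩
  · intro Γ Λ x y z hxy hyz h
    rw [Γ.isInvolutionOf_iff Λ hxy.ne (hxy.trans hyz).ne hyz.ne] at h
    have hδ : δ Λ = -δ Γ := Units.ext <| colouringValue_incidenceDet_eq_neg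
      Γ.isUnit_colouringValue.ne_zero Λ.isUnit_colouringValue.ne_zero
      (HCFPartition.colour_injective.ne h.1) _ _ _ h.2
    rw [hδ, mul_neg]
  · refine ⟨(HCFPartition.identity d).2, ?_⟩
    change δ (HCFPartition.identity d) * (-1) ^ (d + 1) * δ (HCFPartition.identity d) = _
    rw [mul_right_comm, Int.units_mul_self, one_mul]

/-- A sign map determines the partner of a partition with respect to a triangle. -/
theorem IsS2Sign.eq_of_isInvolutionOf {d : ℕ} {ε : HCFPartition d → ℤˣ} (hε : IsS2Sign ε)
    {Γ Λ M : HCFPartition d} {x y z : Fin (2 * d)} (hxy : x < y) (hyz : y < z)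
    (hΛ : IsInvolutionOf Γ Λ x y z) (hM : IsInvolutionOf Λ M x y z) : M = Γ := by
  by_contra hne
  -- Otherwise `Γ`, `Λ` and `M` would have pairwise opposite signs, which is impossible for three
  -- signs.
  have h : IsInvolutionOf Γ M x y z :=
    ⟨hne, fun c s h1 h2 h3 => (hM.2 c s h1 h2 h3).trans (hΛ.2 c s h1 h2 h3)⟩
  have h1 := hε.involution _ _ x y z hxy hyz hΛ
  have h2 := hε.involution _ _ x y z hxy hyz hM
  have h3 := hε.involution _ _ x y z hxy hyz h
  rw [h1, h3, neg_neg] at h2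
  rcases Int.units_eq_one_or (ε Γ) with h | h <;> rw [h] at h2 <;> exact absurd h2 (by decide)

open Classical in
/-- The signed sum over all partitions as a multilinear map in the columns. -/
noncomputable def s2SignedSumMultilinear {d : ℕ} (k : Type*) [Field k] (ε : HCFPartition d → ℤˣ) :
    MultilinearMap k (fun _ : S2Pair d => Fin d → k) k :=
  ∑ Γ : HCFPartition d, ((ε Γ : ℤ) : k) •
    (MultilinearMap.mkPiAlgebra k (S2Pair d) k).compLinearMap fun p => LinearMap.proj (Γ.colour p)

theorem s2SignedSumMultilinear_apply {d : ℕ} {k : Type*} [Field k] (ε : HCFPartition d → ℤˣ)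
    (v : S2Pair d → Fin d → k) : s2SignedSumMultilinear k ε v = s2SignedSum ε v := by
  simp [s2SignedSumMultilinear, s2SignedSum,
    HCFPartition.s2Monomial_eq]

/-- Pairing each partition with its partner on the triangle is a fixed-point-free involution that
preserves the monomial and reverses the sign. -/
theorem IsS2Sign.vanishesOnTriangles {d : ℕ} (k : Type*) [Field k] {ε : HCFPartition d → ℤˣ}
    (hε : IsS2Sign ε) : VanishesOnTriangles (s2SignedSumMultilinear k ε) := by
  classical
  intro v x y z hxy hyz h1 h2
  have hxz := hxy.trans hyz
  obtain ⟨n1, n2, n3⟩ := s2PairOf_triangle_ne hxy.ne hxz.ne hyz.ne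
  rw [← s2PairOf_of_lt, ← s2PairOf_of_lt] at h1 h2
  rw [s2SignedSumMultilinear_apply, s2SignedSum]
  choose partner hne hagree using fun Γ : HCFPartition d =>
    Γ.exists_agree hxy.ne hxz.ne hyz.ne
  have hinv : ∀ Γ, IsInvolutionOf Γ (partner Γ) x y z := fun Γ =>
    (Γ.isInvolutionOf_iff _ hxy.ne hxz.ne hyz.ne).2 ⟨hne Γ, hagree Γ⟩
  refine Finset.sum_involution (fun Γ _ => partner Γ) ?_ (fun Γ _ _ => hne Γ)
    (fun _ _ => Finset.mem_univ _)
    (fun Γ _ => hε.eq_of_isInvolutionOf hxy hyz (hinv Γ) (hinv (partner Γ)))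
  intro Γ _
  rw [hε.involution _ _ x y z hxy hyz (hinv Γ), HCFPartition.s2Monomial_eq,
    HCFPartition.s2Monomial_eq, Γ.prod_eq_of_agree (partner Γ) n1 n2 n3 (hagree Γ) h1 h2]
  push_cast
  ring

/-- At `E_d` every monomial vanishes except that of its own partition, which contributes `±1`. -/
theorem colouringValue_s2SignedSumMultilinear_ne_zero {d : ℕ} (k : Type*) [Field k]
    (ε : HCFPartition d → ℤˣ) : colouringValue (s2SignedSumMultilinear k ε) s2Index ≠ 0 := by
  classical
  rw [colouringValue, s2SignedSumMultilinear_apply, s2SignedSum,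
    Finset.sum_eq_single (HCFPartition.identity d), HCFPartition.s2Monomial_eq,
    HCFPartition.colour_identity]
  · rcases Int.units_eq_one_or (ε (HCFPartition.identity d)) with h | h <;> simp [h]
  · intro Γ _ hΓ
    rw [← HCFPartition.colour_injective.ne_iff, HCFPartition.colour_identity,
      Function.ne_iff] at hΓ
    obtain ⟨p, hp⟩ := hΓ
    rw [HCFPartition.s2Monomial_eq, Finset.prod_eq_zero (Finset.mem_univ p), mul_zero]
    exact Pi.single_eq_of_ne hp 1
  · exact fun h => absurd (Finset.mem_univ _) h

theorem IsS2Sign.exists_isDetS2 {d : ℕ} (k : Type*) [Field k] {ε : HCFPartition d → ℤˣ}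
    (hε : IsS2Sign ε) : ∃ D : S2Tensor d k →ₗ[k] k, IsDetS2 D ∧
      ∀ v : S2Pair d → Fin d → k, D (PiTensorProduct.tprod k v) = s2SignedSum ε v := by
  refine ⟨PiTensorProduct.lift (s2SignedSumMultilinear k ε), ⟨fun h0 => ?_, ?_⟩, ?_⟩
  · apply colouringValue_s2SignedSumMultilinear_ne_zero k ε
    rw [colouringValue, ← PiTensorProduct.lift.tprod, h0, LinearMap.zero_apply]
  · intro v x y z hxy hyz h1 h2
    rw [PiTensorProduct.lift.tprod]
    exact hε.vanishesOnTriangles k v x y z hxy hyz h1 h2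
  · intro v
    rw [PiTensorProduct.lift.tprod, s2SignedSumMultilinear_apply]

/-! ### The product formula -/

theorem mem_s2DiagIndicator {d : ℕ} {k : Type*} [Field k] {p : S2Pair d} {l : Fin d} :
    (p, l) ∈ s2DiagIndicator d k ↔ s2Index p = l := by
  simp [s2DiagIndicator, s2Identity, Pi.single_apply, eq_comm]

theorem s2DiagProd_eq {d : ℕ} {k : Type*} [Field k] (A : S2Matrix d k) :
    s2DiagProd A = ∏ p, A (s2Index p) p := by
  rw [s2DiagProd]
  refine Finset.prod_bij' (fun q _ => q.1) (fun p _ => (p, s2Index p)) (by simp)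
    (fun p _ => mem_s2DiagIndicator.2 rfl) ?_ (by simp) ?_
  · rintro ⟨p, l⟩ h
    rw [mem_s2DiagIndicator.1 h]
  · rintro ⟨p, l⟩ h
    rw [mem_s2DiagIndicator.1 h]

theorem IsS2UpperTriangular.apply_eq_zero {d : ℕ} {k : Type*} [Field k] {A : S2Matrix d k}
    (hA : IsS2UpperTriangular A) {p : S2Pair d} {l : Fin d} (h : s2Index p < l) : A l p = 0 := by
  obtain ⟨α, hα⟩ := hA p (s2Index p) (mem_s2DiagIndicator.2 rfl)
  have := congrFun hα l
  rw [Matrix.col_apply] at this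
  rw [this, Finset.sum_apply]
  refine Finset.sum_eq_zero fun m hm => ?_
  rw [Pi.smul_apply, Pi.single_eq_of_ne ((Finset.mem_Iic.1 hm).trans_lt h).ne', smul_zero]

theorem IsDetS2.apply_of_isS2UpperTriangular {d : ℕ} {k : Type*} [Field k] (hk : ringChar k ≠ 2)
    {D : S2Tensor d k →ₗ[k] k} (hD : IsDetS2 D) {A : S2Matrix d k} (hA : IsS2UpperTriangular A) :
    D (s2SimpleTensor A) = D (s2SimpleTensor (s2Identity d k)) * s2DiagProd A := by
  have h2 : ∀ x : k, 2 * x = 0 → x = 0 := fun x hx =>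
    (mul_eq_zero.1 hx).resolve_left (Ring.two_ne_zero hk)
  have hφ : VanishesOnTriangles (D.compMultilinearMap (PiTensorProduct.tprod k)) := hD.vanish
  rw [s2DiagProd_eq]
  exact hφ.apply_of_upperTriangular h2 (v := fun p => A.col p) fun p l h => hA.apply_eq_zero h

theorem corollary3p1 {k : Type*} [Field k] (hk2 : ringChar k ≠ 2) (hk3 : ringChar k ≠ 3)
    (d : ℕ) (hd : d = 2 ∨ d = 3) :
    -- the sign map, and with it the map `det^{S²}` given by the signed sum, exist
    (∃ ε : HCFPartition d → ℤˣ, IsS2Sign ε) ∧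
    (∀ ε : HCFPartition d → ℤˣ, IsS2Sign ε →
      ∃ D : S2Tensor d k →ₗ[k] k, IsDetS2 D ∧
        ∀ v : S2Pair d → Fin d → k, D (PiTensorProduct.tprod k v) = s2SignedSum ε v) ∧
    -- the product formula, for every normalization of `det^{S²}`
    (∀ D : S2Tensor d k →ₗ[k] k, IsDetS2 D →
      ∀ A : S2Matrix d k, IsS2UpperTriangular A →
        D (s2SimpleTensor A) = D (s2SimpleTensor (s2Identity d k)) * s2DiagProd A) :=
  ⟨exists_isS2Sign d, fun _ hε => hε.exists_isDetS2 k,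
    fun _ hD _ hA => hD.apply_of_isS2UpperTriangular hk2 hA⟩
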